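/- Let $d\ge 1$ be an integer. Call a non-negative Borel measure $\mu$ on $\mathbb R^d$ admissible if it has moments of all orders, i.e. every monomial $\mathbf x^\alpha=x_1^{\alpha_1}\cdots x_d^{\alpha_d}$, $\alpha\in\mathbb N_0^d$, is $\mu$-integrable, and let $s_\alpha(\mu)=\int \mathbf x^\alpha\,d\mu(\mathbf x)$. Let $\mathcal M([-1,1]^d)$ be the set of all moment families $(s_\alpha(\mu))_{\alpha\in\mathbb N_0^d}$ of admissible measures $\mu$ supported on $[-1,1]^d$. A function $F:\mathbb R\to\mathbb R$, applied entrywise, maps $\mathcal M([-1,1]^d)$ into itself (that is, $(F(s_\alpha))_{\alpha\in\mathbb N_0^d}\in\mathcal M([-1,1]^d)$ for every $(s_\alpha)_{\alpha\in\mathbb N_0^d}\in\mathcal M([-1,1]^d)$) if and only if $F$ is the restriction to $\mathbb R$ of an absolutely monotonic entire function, i.e. of an entire function $G:\mathbb C\to\mathbb C$ whose Taylor coefficients at every point of $(0,\infty)$ are non-negative real numbers. -/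

import Mathlib

open MeasureTheory

namespace MomentTransform

/-- The monomial `x ^ α = x₁ ^ α₁ ⋯ x_d ^ α_d` on `ℝ^d`. -/
def monom {d : ℕ} (α : Fin d → ℕ) (x : Fin d → ℝ) : ℝ :=
  ∏ i, x i ^ α i

/-- A non-negative Borel measure on `ℝ^d` is admissible if it has moments of all orders. -/
def Admissible {d : ℕ} (μ : Measure (Fin d → ℝ)) : Prop :=
  ∀ α : Fin d → ℕ, Integrable (monom α) μ

/-- The moment family `s_α(μ) = ∫ x ^ α dμ(x)`, indexed by all multi-indices `α`. -/
noncomputable def momentFamily {d : ℕ} (μ : Measure (Fin d → ℝ)) : (Fin d → ℕ) → ℝ :=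
  fun α => ∫ x, monom α x ∂μ

/-- The set of all moment families of admissible measures supported on `K ⊆ ℝ^d`. -/
def momentSet {d : ℕ} (K : Set (Fin d → ℝ)) : Set ((Fin d → ℕ) → ℝ) :=
  {s | ∃ μ : Measure (Fin d → ℝ), Admissible μ ∧ μ Kᶜ = 0 ∧ momentFamily μ = s}

/-- The cube `[-1, 1]^d`. -/
def cube (d : ℕ) : Set (Fin d → ℝ) :=
  {x | ∀ i, x i ∈ Set.Icc (-1 : ℝ) 1}

/-- An absolutely monotonic entire function: an entire function whose Taylor coefficients at
every point of `(0, ∞)` are non-negative real numbers. -/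
def AbsMonotonicEntire (G : ℂ → ℂ) : Prop :=
  Differentiable ℂ G ∧
    ∀ x : ℝ, 0 < x → ∀ n : ℕ,
      ∃ c : ℝ, 0 ≤ c ∧ iteratedDeriv n G (x : ℂ) / (n.factorial : ℂ) = (c : ℂ)

end MomentTransform

/-!
Let `F` preserve the moment families and let `-1 < u < 0` be a coordinate of a point of the cube.
The measures `a δ₁ + b δᵤ` show that the sequences `F (a + b * u ^ n)` are moment sequences on
`[-1, 1]`, hence positive semidefinite. Expanding at `b = 0` the Hankel form of a polynomial that
vanishes at `u ^ k` for all `k < m` gives `0 ≤ F⁽ᵐ⁾(a)` when `F` is smooth. In general `F` is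
monotone on `[0, ∞)`; its mollifications are absolutely monotone, hence power series with
non-negative coefficients by Bernstein's theorem, and squeezing makes `F` such a series on
`(0, ∞)`. The series agrees with `F` at the other points as well, because the first moment of a
measure on `[-1, 1]` is determined by the remaining ones, and `x ≤ 0` can be written as
`a + b * u` with `a + b * u ^ n > 0` for all `n ≠ 1`. Conversely, moment families are closed under
products (multiplicative convolution), non-negative multiples and convergent sums.
-/

namespace MomentTransform

open Filter Topology Set
open scoped ContDiff Nat Polynomial ComplexOrder

/-- On `s`, the function `f` is the sum of a power series at `0` with non-negative coefficients.
For `s = univ` this is the real form of an absolutely monotonic entire function. -/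
def IsNonnegPowerSeriesOn (f : ℝ → ℝ) (s : Set ℝ) : Prop :=
  ∃ c : ℕ → ℝ, (∀ k, 0 ≤ c k) ∧ ∀ x ∈ s, HasSum (fun k => c k * x ^ k) (f x)

/-! ### Operations on moment families -/

theorem integrable_of_continuous_of_compl_null {X : Type*} [TopologicalSpace X] [T2Space X]
    [MeasurableSpace X] [OpensMeasurableSpace X] {K : Set X} (hK : IsCompact K) {μ : Measure X}
    [IsFiniteMeasure μ] (hμ : μ Kᶜ = 0) {g : X → ℝ} (hg : Continuous g) : Integrable g μ := by
  rw [← Measure.restrict_eq_self_of_ae_mem (mem_ae_iff.2 hμ)]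
  exact hg.continuousOn.integrableOn_compact hK

section MomentSet

variable {d : ℕ} {K : Set (Fin d → ℝ)} {s t : (Fin d → ℕ) → ℝ}

theorem continuous_monom (α : Fin d → ℕ) : Continuous (monom α) := by
  unfold monom
  fun_prop

@[simp]
theorem monom_zero (x : Fin d → ℝ) : monom 0 x = 1 := by
  simp [monom]

@[simp]
theorem monom_one (α : Fin d → ℕ) : monom α 1 = 1 := by
  simp [monom]

theorem monom_mul (α : Fin d → ℕ) (x y : Fin d → ℝ) :
    monom α (x * y) = monom α x * monom α y := by
  simp [monom, mul_pow, Finset.prod_mul_distrib]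

@[simp]
theorem monom_single (i : Fin d) (n : ℕ) (x : Fin d → ℝ) : monom (Pi.single i n) x = x i ^ n := by
  rw [monom, Finset.prod_eq_single i (fun j _ hj => by simp [hj]) (by simp), Pi.single_eq_same]

theorem Admissible.isFiniteMeasure {μ : Measure (Fin d → ℝ)} (hμ : Admissible μ) :
    IsFiniteMeasure μ := by
  have h_one : Integrable (fun _ => (1 : ℝ)) μ := (hμ 0).congr (.of_forall monom_zero)
  simpa [integrable_const_iff] using h_one

theorem dirac_mem_momentSet {x : Fin d → ℝ} (hx : x ∈ K) : (fun α => monom α x) ∈ momentSet K :=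
  ⟨Measure.dirac x, fun _ => integrable_dirac (by simp), by simp [hx], by
    ext
    simp [momentFamily]⟩

theorem add_mem_momentSet (hs : s ∈ momentSet K) (ht : t ∈ momentSet K) : s + t ∈ momentSet K := by
  obtain ⟨μ, hμ, hμK, rfl⟩ := hs
  obtain ⟨ν, hν, hνK, rfl⟩ := ht
  exact ⟨μ + ν, fun α => (hμ α).add_measure (hν α), by simp [hμK, hνK],
    funext fun α => integral_add_measure (hμ α) (hν α)⟩

theorem smul_mem_momentSet {c : ℝ} (hc : 0 ≤ c) (hs : s ∈ momentSet K) : c • s ∈ momentSet K := by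
  obtain ⟨μ, hμ, hμK, rfl⟩ := hs
  refine ⟨ENNReal.ofReal c • μ, fun α => (hμ α).smul_measure ENNReal.ofReal_ne_top,
    by simp [hμK], funext fun α => ?_⟩
  simp [momentFamily, ENNReal.toReal_ofReal hc]

/-- Multiplicative convolution of measures turns into multiplication of moments. -/
theorem mul_mem_momentSet {M : Submonoid (Fin d → ℝ)} (hM : MeasurableSet (M : Set (Fin d → ℝ)))
    (hs : s ∈ momentSet M) (ht : t ∈ momentSet M) : s * t ∈ momentSet M := by
  obtain ⟨μ, hμ, hμM, rfl⟩ := hs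
  obtain ⟨ν, hν, hνM, rfl⟩ := ht
  have := hμ.isFiniteMeasure
  have := hν.isFiniteMeasure
  have hmul : Measurable fun p : (Fin d → ℝ) × (Fin d → ℝ) => p.1 * p.2 := by fun_prop
  refine ⟨μ.mconv ν, fun α => ?_, ?_, funext fun α => ?_⟩
  · rw [Measure.mconv, integrable_map_measure (continuous_monom α).aestronglyMeasurable
      hmul.aemeasurable]
    simpa only [Function.comp_def, monom_mul] using (hμ α).mul_prod (hν α)
  · rw [← mem_ae_iff, Measure.mconv, mem_ae_map_iff hmul.aemeasurable hM]
    filter_upwards [Measure.quasiMeasurePreserving_fst.ae (mem_ae_iff.2 hμM),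
      Measure.quasiMeasurePreserving_snd.ae (mem_ae_iff.2 hνM)] with p hp₁ hp₂
    exact M.mul_mem hp₁ hp₂
  · rw [momentFamily, Measure.mconv, integral_map hmul.aemeasurable
      (continuous_monom α).aestronglyMeasurable]
    simp only [monom_mul]
    exact integral_prod_mul _ _

theorem pow_mem_momentSet {M : Submonoid (Fin d → ℝ)} (hM : MeasurableSet (M : Set (Fin d → ℝ)))
    (hs : s ∈ momentSet M) (k : ℕ) : s ^ k ∈ momentSet M := by
  induction k with
  | zero => simpa only [monom_one] using! dirac_mem_momentSet M.one_mem
  | succ k ih => exact pow_succ s k ▸ mul_mem_momentSet hM ih hs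

theorem hasSum_mem_momentSet (hK : IsCompact K) {s : ℕ → (Fin d → ℕ) → ℝ}
    (hs : ∀ k, s k ∈ momentSet K) (ht : ∀ α, HasSum (fun k => s k α) (t α)) :
    t ∈ momentSet K := by
  choose μ hμ hμK hμs using hs
  have hμ_fin (k : ℕ) : IsFiniteMeasure (μ k) := (hμ k).isFiniteMeasure
  have hmass (k : ℕ) : μ k univ = ENNReal.ofReal (s k 0) := by
    simp [← hμs, momentFamily]
  have hmass_nonneg (k : ℕ) : 0 ≤ s k 0 := by
    simp [← hμs, momentFamily]
  have hfin : IsFiniteMeasure (Measure.sum μ) := by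
    refine ⟨?_⟩
    simp only [Measure.sum_apply _ MeasurableSet.univ, hmass]
    rw [← ENNReal.ofReal_tsum_of_nonneg hmass_nonneg (ht 0).summable]
    exact ENNReal.ofReal_lt_top
  have hnull : Measure.sum μ Kᶜ = 0 := Measure.sum_apply_eq_zero' hK.measurableSet.compl |>.2 hμK
  have hadm : Admissible (Measure.sum μ) := fun α =>
    integrable_of_continuous_of_compl_null hK hnull (continuous_monom α)
  refine ⟨Measure.sum μ, hadm, hnull, funext fun α => ?_⟩
  have hsum : HasSum (fun k => s k α) (∫ x, monom α x ∂Measure.sum μ) := by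
    simpa only [← hμs, momentFamily] using hasSum_integral_measure (hadm α)
  exact hsum.unique (ht α)

theorem IsNonnegPowerSeriesOn.comp_mem_momentSet {F : ℝ → ℝ} (hF : IsNonnegPowerSeriesOn F univ)
    {M : Submonoid (Fin d → ℝ)} (hM : IsCompact (M : Set (Fin d → ℝ))) (hs : s ∈ momentSet M) :
    (fun α => F (s α)) ∈ momentSet M := by
  obtain ⟨c, hc, hF⟩ := hF
  exact hasSum_mem_momentSet hM
    (fun k => smul_mem_momentSet (hc k) (pow_mem_momentSet hM.measurableSet hs k))
    fun α => hF (s α) (mem_univ _)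

end MomentSet

/-! ### Moment sequences on `[-1, 1]` -/

/-- `m` is the moment sequence of a finite measure on `[-1, 1]`. -/
def IsIntervalMoment (m : ℕ → ℝ) : Prop :=
  ∃ σ : Measure ℝ, IsFiniteMeasure σ ∧ σ (Icc (-1) 1)ᶜ = 0 ∧ ∀ n, ∫ x, x ^ n ∂σ = m n

/-- The Riesz functional of `m`, i.e. the linear functional on polynomials with `X ^ n ↦ m n`. -/
noncomputable def rieszFunctional (m : ℕ → ℝ) (p : ℝ[X]) : ℝ :=
  p.sum fun n r => r * m n

/-- `m` is positive semidefinite: its Hankel forms `∑ i, ∑ j, q i * q j * m (i + j)` are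
non-negative. The form is written as the Riesz functional at the square of `∑ i, q i * X ^ i`. -/
def IsPosSemidefSeq (m : ℕ → ℝ) : Prop :=
  ∀ q : ℝ[X], 0 ≤ rieszFunctional m (q ^ 2)

theorem rieszFunctional_sub_rieszFunctional {m m' : ℕ → ℝ} {k : ℕ} (h : ∀ n ≠ k, m n = m' n)
    (p : ℝ[X]) :
    rieszFunctional m p - rieszFunctional m' p = p.coeff k * (m k - m' k) := by
  simp only [rieszFunctional, Polynomial.sum, ← Finset.sum_sub_distrib, ← mul_sub]
  refine Finset.sum_eq_single k (fun n _ hn => by simp [h n hn]) fun hk => ?_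
  simp [Polynomial.notMem_support_iff.1 hk]

section IntervalMeasure

variable {σ : Measure ℝ} [IsFiniteMeasure σ]

theorem integrable_pow_of_compl_null (hσ : σ (Icc (-1) 1)ᶜ = 0) (n : ℕ) :
    Integrable (fun x => x ^ n) σ :=
  integrable_of_continuous_of_compl_null isCompact_Icc hσ (by fun_prop)

theorem integral_eval_eq_rieszFunctional (hσ : σ (Icc (-1) 1)ᶜ = 0) {m : ℕ → ℝ}
    (hm : ∀ n, ∫ x, x ^ n ∂σ = m n) (p : ℝ[X]) :
    ∫ x, p.eval x ∂σ = rieszFunctional m p := by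
  simp only [rieszFunctional, ← hm, Polynomial.eval_eq_sum, Polynomial.sum, ← integral_const_mul]
  exact integral_finsetSum _ fun n _ => (integrable_pow_of_compl_null hσ n).const_mul _

theorem tendsto_integral_mul_one_sub_sq_pow (hσ : σ (Icc (-1) 1)ᶜ = 0) :
    Tendsto (fun k : ℕ => ∫ x, x * (1 - x ^ 2) ^ k ∂σ) atTop (𝓝 0) := by
  have h_sq {x : ℝ} (hx : x ∈ Icc (-1 : ℝ) 1) : x ^ 2 ≤ 1 :=
    (sq_le_one_iff_abs_le_one x).2 (abs_le.2 hx)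
  rw [← integral_zero ℝ ℝ (μ := σ)]
  refine tendsto_integral_of_dominated_convergence (fun _ => 1)
    (fun k => (by fun_prop : Continuous _).aestronglyMeasurable) (integrable_const 1)
    (fun k => ?_) ?_
  · filter_upwards [mem_ae_iff.2 hσ] with x hx
    rw [Real.norm_eq_abs, abs_mul, abs_pow, abs_of_nonneg (sub_nonneg.2 (h_sq hx))]
    exact mul_le_one₀ (abs_le.2 hx) (pow_nonneg (sub_nonneg.2 (h_sq hx)) k)
      (pow_le_one₀ (sub_nonneg.2 (h_sq hx)) (sub_le_self 1 (sq_nonneg x)))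
  · filter_upwards [mem_ae_iff.2 hσ] with x hx
    rcases eq_or_ne x 0 with rfl | hx0
    · simp
    · simpa using (tendsto_pow_atTop_nhds_zero_of_lt_one (sub_nonneg.2 (h_sq hx))
        (sub_lt_self 1 (by positivity))).const_mul x

end IntervalMeasure

namespace IsIntervalMoment

variable {m m' : ℕ → ℝ}

theorem isPosSemidefSeq (hm : IsIntervalMoment m) : IsPosSemidefSeq m := fun q => by
  obtain ⟨σ, _, hσ, hm⟩ := hm
  rw [← integral_eval_eq_rieszFunctional hσ hm]
  exact integral_nonneg fun x => by simpa using sq_nonneg (q.eval x)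

theorem le_apply_zero (hm : IsIntervalMoment m) (n : ℕ) : m n ≤ m 0 := by
  obtain ⟨σ, _, hσ, hm⟩ := hm
  rw [← hm, ← hm]
  refine integral_mono_ae (integrable_pow_of_compl_null hσ n) (integrable_pow_of_compl_null hσ 0) ?_
  filter_upwards [mem_ae_iff.2 hσ] with x hx
  rw [pow_zero]
  exact (le_abs_self _).trans ((abs_pow x n).trans_le (pow_le_one₀ (abs_nonneg x) (abs_le.2 hx)))

/-- The polynomials `X * (1 - X ^ 2) ^ k` have linear coefficient `1`, and their integrals tend
to `0` as `k → ∞`. -/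
theorem apply_one_eq (hm : IsIntervalMoment m) (hm' : IsIntervalMoment m')
    (h : ∀ n ≠ 1, m n = m' n) : m 1 = m' 1 := by
  obtain ⟨σ, _, hσ, hm⟩ := hm
  obtain ⟨τ, _, hτ, hm'⟩ := hm'
  have hdiff (k : ℕ) :
      ∫ x, x * (1 - x ^ 2) ^ k ∂σ - ∫ x, x * (1 - x ^ 2) ^ k ∂τ = m 1 - m' 1 := by
    let p : ℝ[X] := Polynomial.X * (1 - Polynomial.X ^ 2) ^ k
    have hp_coeff : p.coeff 1 = 1 := by
      simp [p, Polynomial.coeff_zero_eq_eval_zero]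
    have hp_eval (x : ℝ) : p.eval x = x * (1 - x ^ 2) ^ k := by simp [p]
    simp only [← hp_eval]
    rw [integral_eval_eq_rieszFunctional hσ hm, integral_eval_eq_rieszFunctional hτ hm',
      rieszFunctional_sub_rieszFunctional h, hp_coeff, one_mul]
  have hlim := (tendsto_integral_mul_one_sub_sq_pow hσ).sub (tendsto_integral_mul_one_sub_sq_pow hτ)
  simp only [hdiff, sub_zero] at hlim
  exact sub_eq_zero.1 (tendsto_nhds_unique tendsto_const_nhds hlim)

end IsIntervalMoment

theorem isIntervalMoment_of_mem_momentSet {d : ℕ} {K : Set (Fin d → ℝ)} (i : Fin d)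
    (hK : ∀ x ∈ K, x i ∈ Icc (-1 : ℝ) 1) {s : (Fin d → ℕ) → ℝ} (hs : s ∈ momentSet K) :
    IsIntervalMoment fun n => s (Pi.single i n) := by
  obtain ⟨μ, hμ, hμK, rfl⟩ := hs
  have := hμ.isFiniteMeasure
  refine ⟨μ.map fun x => x i, inferInstance, ?_, fun n => ?_⟩
  · rw [Measure.map_apply (measurable_pi_apply i) measurableSet_Icc.compl]
    exact measure_mono_null (fun x hx hxK => hx (hK x hxK)) hμK
  · rw [integral_map (measurable_pi_apply i).aemeasurable (by fun_prop)]
    simp only [momentFamily, monom_single]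

/-- `F`, applied entrywise, maps the moment sequences `(a + b * u ^ n)ₙ` of the measures
`a δ₁ + b δᵤ` with masses `a, b ≥ 0` to moment sequences on `[-1, 1]`. -/
def PreservesTwoAtomMoments (u : ℝ) (F : ℝ → ℝ) : Prop :=
  ∀ ⦃a⦄, 0 ≤ a → ∀ ⦃b⦄, 0 ≤ b → IsIntervalMoment fun n => F (a + b * u ^ n)

theorem preservesTwoAtomMoments_of_forall_mem_momentSet {d : ℕ} {K : Set (Fin d → ℝ)} {i : Fin d}
    (hK : ∀ x ∈ K, x i ∈ Icc (-1 : ℝ) 1) (h1 : 1 ∈ K) {v : Fin d → ℝ} (hv : v ∈ K) {F : ℝ → ℝ}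
    (hF : ∀ s ∈ momentSet K, (fun α => F (s α)) ∈ momentSet K) :
    PreservesTwoAtomMoments (v i) F := fun a ha b hb => by
  simpa using isIntervalMoment_of_mem_momentSet i hK
    (hF _ (add_mem_momentSet (smul_mem_momentSet ha (dirac_mem_momentSet h1))
      (smul_mem_momentSet hb (dirac_mem_momentSet hv))))

/-- Otherwise the powers of `x` are unbounded. -/
theorem apply_mem_Icc_of_mem_isCompact {d : ℕ} {M : Submonoid (Fin d → ℝ)}
    (hM : IsCompact (M : Set (Fin d → ℝ))) {x : Fin d → ℝ} (hx : x ∈ M) (i : Fin d) :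
    x i ∈ Icc (-1 : ℝ) 1 := by
  obtain ⟨C, hC⟩ := hM.exists_bound_of_continuousOn (continuous_apply i).continuousOn
  refine abs_le.1 (not_lt.1 fun hxi => ?_)
  obtain ⟨n, hn⟩ := pow_unbounded_of_one_lt C hxi
  refine hn.not_ge ?_
  simpa using hC (x ^ n) (M.pow_mem hx n)

/-- The cube `[-1, 1]^d` as a submonoid of `ℝ^d` with coordinatewise multiplication. -/
def cubeSubmonoid (d : ℕ) : Submonoid (Fin d → ℝ) where
  carrier := cube d
  one_mem' i := by simp
  mul_mem' {x y} hx hy i := by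
    rw [Pi.mul_apply, mem_Icc, ← abs_le, abs_mul]
    exact mul_le_one₀ (abs_le.2 (hx i)) (abs_nonneg _) (abs_le.2 (hy i))

theorem isCompact_cube (d : ℕ) : IsCompact (cube d) := by
  have hcube : cube d = univ.pi fun _ => Icc (-1) 1 := by
    ext
    simp only [cube, mem_ofPred_eq, mem_univ_pi]
  exact hcube ▸ isCompact_univ_pi fun _ => isCompact_Icc

/-! ### Derivatives of functions with positive semidefinite samples -/

theorem iteratedDeriv_nonneg_of_eventually_nonneg {ψ : ℝ → ℝ} {m : ℕ} (hψ : ContDiff ℝ m ψ)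
    {x₀ : ℝ} (h0 : ∀ k < m, iteratedDeriv k ψ x₀ = 0) (hpos : ∀ᶠ x in 𝓝[>] x₀, 0 ≤ ψ x) :
    0 ≤ iteratedDeriv m ψ x₀ := by
  have htaylor (x : ℝ) :
      taylorWithinEval ψ m univ x₀ x = (m ! : ℝ)⁻¹ * iteratedDeriv m ψ x₀ * (x - x₀) ^ m := by
    rw [taylor_within_apply, Finset.sum_range_succ, Finset.sum_eq_zero fun k hk => by
      rw [iteratedDerivWithin_univ, h0 k (Finset.mem_range.1 hk), smul_zero]]
    simp only [iteratedDerivWithin_univ, smul_eq_mul]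
    ring
  have hquot : Tendsto (fun x => ψ x / (x - x₀) ^ m) (𝓝[>] x₀)
      (𝓝 ((m ! : ℝ)⁻¹ * iteratedDeriv m ψ x₀)) := by
    have hrem := ((Real.taylor_tendsto convex_univ (mem_univ x₀) hψ.contDiffOn).mono_left
      (nhdsWithin_mono x₀ (subset_univ (Ioi x₀)))).add_const ((m ! : ℝ)⁻¹ * iteratedDeriv m ψ x₀)
    rw [zero_add] at hrem
    refine hrem.congr' ?_
    filter_upwards [self_mem_nhdsWithin] with x hx
    have hx : (x - x₀) ^ m ≠ 0 := pow_ne_zero m (sub_ne_zero.2 (ne_of_gt hx))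
    rw [htaylor, sub_div, mul_div_cancel_right₀ _ hx, sub_add_cancel]
  refine nonneg_of_mul_nonneg_right (ge_of_tendsto hquot ?_) (by positivity : 0 < (m ! : ℝ)⁻¹)
  filter_upwards [hpos, self_mem_nhdsWithin] with x hx hx₀
  exact div_nonneg hx (pow_nonneg (sub_nonneg.2 (le_of_lt hx₀)) m)

section Samples

variable {f : ℝ → ℝ} {k m : ℕ}

theorem contDiff_rieszFunctional (hf : ContDiff ℝ m f) (a u : ℝ) (p : ℝ[X]) :
    ContDiff ℝ m fun b => rieszFunctional (fun n => f (a + b * u ^ n)) p :=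
  ContDiff.sum fun _ _ => contDiff_const.mul (hf.comp (by fun_prop))

theorem iteratedDeriv_comp_add_mul (hf : ContDiff ℝ k f) (a r : ℝ) :
    iteratedDeriv k (fun b => f (a + b * r)) 0 = r ^ k * iteratedDeriv k f a := by
  have hfa : ContDiff ℝ k fun y => f (a + y) := hf.comp (by fun_prop)
  have h := congrFun (iteratedDeriv_comp_const_mul hfa r) 0
  simpa only [iteratedDeriv_comp_const_add, mul_zero, zero_mul, add_zero, mul_comm r] using h

theorem iteratedDeriv_rieszFunctional (hf : ContDiff ℝ k f) (a u : ℝ) (p : ℝ[X]) :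
    iteratedDeriv k (fun b => rieszFunctional (fun n => f (a + b * u ^ n)) p) 0 =
      p.eval (u ^ k) * iteratedDeriv k f a := by
  have hterm (n : ℕ) : ContDiff ℝ k fun b => p.coeff n * f (a + b * u ^ n) :=
    contDiff_const.mul (hf.comp (by fun_prop))
  simp only [rieszFunctional, Polynomial.sum]
  rw [iteratedDeriv_fun_sum fun n _ => (hterm n).contDiffAt]
  simp only [iteratedDeriv_const_mul_field, iteratedDeriv_comp_add_mul hf,
    Polynomial.eval_eq_sum, Polynomial.sum, Finset.sum_mul, ← pow_mul, mul_comm k, mul_assoc]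

/-- For `q = ∏ k < m, (X - u ^ k)`, the function `b ↦ ∑ n, (q²)ₙ f (a + b * u ^ n)` is non-negative
for small `b > 0`, and its derivatives at `0` of order `k` are `q (u ^ k)²` times those of `f` at
`a`, so that all those of order less than `m` vanish. -/
theorem iteratedDeriv_nonneg_of_isPosSemidefSeq (hf : ContDiff ℝ m f) {a u : ℝ}
    (hu : Function.Injective fun n : ℕ => u ^ n)
    (h : ∀ᶠ b in 𝓝[>] (0 : ℝ), IsPosSemidefSeq fun n => f (a + b * u ^ n)) :
    0 ≤ iteratedDeriv m f a := by
  let q : ℝ[X] := ∏ k ∈ Finset.range m, (Polynomial.X - Polynomial.C (u ^ k))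
  have hq (x : ℝ) : q.eval x = ∏ k ∈ Finset.range m, (x - u ^ k) := by
    simp [q, Polynomial.eval_prod]
  have hq_zero {k : ℕ} (hk : k < m) : q.eval (u ^ k) = 0 := by
    rw [hq, Finset.prod_eq_zero (Finset.mem_range.2 hk) (sub_self _)]
  have hq_ne : q.eval (u ^ m) ≠ 0 := by
    rw [hq, Finset.prod_ne_zero_iff]
    exact fun k hk => sub_ne_zero.2 (hu.ne (Finset.mem_range.1 hk).ne')
  have hnonneg := iteratedDeriv_nonneg_of_eventually_nonneg
    (contDiff_rieszFunctional hf a u (q ^ 2))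
    (fun k hk => by
      rw [iteratedDeriv_rieszFunctional (hf.of_le (by exact_mod_cast hk.le)), Polynomial.eval_pow,
        hq_zero hk, sq, zero_mul, zero_mul])
    (h.mono fun b hb => hb q)
  rw [iteratedDeriv_rieszFunctional hf, Polynomial.eval_pow] at hnonneg
  exact nonneg_of_mul_nonneg_right hnonneg (by positivity)

end Samples

theorem injective_pow_of_mem_Ioo {u : ℝ} (hu : u ∈ Ioo (-1) 0) :
    Function.Injective fun n : ℕ => u ^ n := by
  have hanti : StrictAnti fun n : ℕ => |u| ^ n :=
    pow_right_strictAnti₀ (abs_pos.2 hu.2.ne) (abs_lt.2 ⟨hu.1, hu.2.trans one_pos⟩)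
  exact fun m n hmn => hanti.injective (by simpa only [abs_pow] using! congrArg abs hmn)

/-! ### Mollification -/

/-- The average of `Φ (x - t)` over `t` near `c`, with the smooth weight `η`. The bump need not be
centred at `0`: moving the centre `c` gives averages over points to one side of `x`. -/
noncomputable def bumpAverage {c : ℝ} (η : ContDiffBump c) (Φ : ℝ → ℝ) (x : ℝ) : ℝ :=
  ∫ t, η.normed volume t * Φ (x - t)

section BumpAverage

variable {c : ℝ} (η : ContDiffBump c) {Φ : ℝ → ℝ}

theorem integrable_normed_mul_comp_sub (hΦ : LocallyIntegrable Φ) (x : ℝ) :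
    Integrable fun t => η.normed volume t * Φ (x - t) := by
  simpa only [ConvolutionExistsAt, ContinuousLinearMap.lsmul_apply, smul_eq_mul] using
    η.hasCompactSupport_normed.convolutionExists_left (ContinuousLinearMap.lsmul ℝ ℝ)
      η.continuous_normed hΦ x

theorem contDiff_bumpAverage (hΦ : LocallyIntegrable Φ) : ContDiff ℝ ∞ (bumpAverage η Φ) :=
  η.hasCompactSupport_normed.contDiff_convolution_left (ContinuousLinearMap.lsmul ℝ ℝ)
    η.contDiff_normed hΦ

theorem normed_eq_zero_of_notMem_ball {t : ℝ} (ht : t ∉ Metric.ball c η.rOut) :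
    η.normed volume t = 0 := by
  rwa [← Function.notMem_support, η.support_normed_eq]

theorem integral_normed_mul_mono {g h : ℝ → ℝ} (hg : Integrable fun t => η.normed volume t * g t)
    (hh : Integrable fun t => η.normed volume t * h t)
    (hgh : ∀ t ∈ Metric.ball c η.rOut, g t ≤ h t) :
    ∫ t, η.normed volume t * g t ≤ ∫ t, η.normed volume t * h t := by
  refine integral_mono hg hh fun t => ?_
  by_cases ht : t ∈ Metric.ball c η.rOut
  · exact mul_le_mul_of_nonneg_left (hgh t ht) (η.nonneg_normed t)
  · simp [normed_eq_zero_of_notMem_ball η ht]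

theorem integral_normed_mul_const (r : ℝ) : ∫ t, η.normed volume t * r = r := by
  rw [integral_mul_const, η.integral_normed, one_mul]

theorem bumpAverage_mem_Icc (hΦ : Monotone Φ) (x : ℝ) :
    bumpAverage η Φ x ∈ Icc (Φ (x - c - η.rOut)) (Φ (x - c + η.rOut)) := by
  have hintegrable := integrable_normed_mul_comp_sub η hΦ.locallyIntegrable x
  have hconst (r : ℝ) : Integrable fun t => η.normed volume t * r :=
    η.integrable_normed.mul_const r
  constructor
  · rw [← integral_normed_mul_const η (Φ _)]
    refine integral_normed_mul_mono η (hconst _) hintegrable fun t ht => hΦ ?_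
    linarith [(abs_lt.1 (Metric.mem_ball.1 ht)).2]
  · rw [← integral_normed_mul_const η (Φ (_ + _))]
    refine integral_normed_mul_mono η hintegrable (hconst _) fun t ht => hΦ ?_
    linarith [(abs_lt.1 (Metric.mem_ball.1 ht)).1]

theorem rieszFunctional_bumpAverage (hΦ : LocallyIntegrable Φ) (y : ℕ → ℝ) (p : ℝ[X]) :
    rieszFunctional (fun n => bumpAverage η Φ (y n)) p =
      ∫ t, η.normed volume t * rieszFunctional (fun n => Φ (y n - t)) p := by
  simp only [rieszFunctional, Polynomial.sum, bumpAverage, Finset.mul_sum, mul_left_comm]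
  rw [integral_finsetSum _ fun n _ =>
    (integrable_normed_mul_comp_sub η hΦ (y n)).const_mul (p.coeff n)]
  simp only [integral_const_mul]

theorem isPosSemidefSeq_bumpAverage (hΦ : LocallyIntegrable Φ) {y : ℕ → ℝ}
    (h : ∀ t ∈ Metric.ball c η.rOut, IsPosSemidefSeq fun n => Φ (y n - t)) :
    IsPosSemidefSeq fun n => bumpAverage η Φ (y n) := fun q => by
  rw [rieszFunctional_bumpAverage η hΦ]
  refine integral_nonneg fun t => ?_
  by_cases ht : t ∈ Metric.ball c η.rOut
  · exact mul_nonneg (η.nonneg_normed t) (h t ht q)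
  · simp [normed_eq_zero_of_notMem_ball η ht]

end BumpAverage

theorem exists_absolutelyMonotoneOn_between {Φ : ℝ → ℝ} (hΦ : Monotone Φ) {u : ℝ}
    (hu : Function.Injective fun n : ℕ => u ^ n)
    (h : ∀ a > 0, ∀ b ∈ Ioo 0 a, IsPosSemidefSeq fun n => Φ (a + b * u ^ n)) {ε : ℝ}
    (hε : 0 < ε) :
    ∃ f, AbsolutelyMonotoneOn f (Ici 0) ∧ ∀ x, f x ∈ Icc (Φ x) (Φ (x + ε)) := by
  let η : ContDiffBump (-(2 * ε / 3)) := ⟨ε / 6, ε / 3, by linarith, by linarith⟩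
  have hη : η.rOut = ε / 3 := rfl
  have hsmooth : ContDiff ℝ ∞ (bumpAverage η Φ) := contDiff_bumpAverage η hΦ.locallyIntegrable
  refine ⟨bumpAverage η Φ, AbsolutelyMonotoneOn.of_contDiff hsmooth fun m a ha => ?_, fun x => ?_⟩
  · refine iteratedDeriv_nonneg_of_isPosSemidefSeq (hsmooth.of_le (by exact_mod_cast le_top)) hu ?_
    filter_upwards [Ioo_mem_nhdsGT (by positivity : 0 < ε / 3)] with b hb
    refine isPosSemidefSeq_bumpAverage η hΦ.locallyIntegrable fun t ht => ?_
    have hbt : b < a - t := by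
      linarith [(abs_lt.1 (Metric.mem_ball.1 ht)).2, mem_Ici.1 ha, hb.2]
    simpa only [add_sub_right_comm] using h (a - t) (hb.1.trans hbt) b ⟨hb.1, hbt⟩
  · have hx := bumpAverage_mem_Icc η hΦ x
    exact ⟨(hΦ (by linarith)).trans hx.1, hx.2.trans (hΦ (by linarith))⟩

/-! ### Bernstein's theorem on a half-line -/

section Bernstein

variable {f : ℝ → ℝ} {a x y : ℝ} {n : ℕ}

theorem iteratedDerivWithin_subset {s t : Set ℝ} (hst : s ⊆ t) (hs : UniqueDiffOn ℝ s)
    (ht : UniqueDiffOn ℝ t) (hf : ContDiffOn ℝ n f t) (hx : x ∈ s) :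
    iteratedDerivWithin n f s x = iteratedDerivWithin n f t x := by
  rw [iteratedDerivWithin_eq_iteratedFDerivWithin, iteratedDerivWithin_eq_iteratedFDerivWithin,
    iteratedFDerivWithin_subset hst hs ht hf hx]

theorem taylorWithinEval_subset {s t : Set ℝ} (hst : s ⊆ t) (hs : UniqueDiffOn ℝ s)
    (ht : UniqueDiffOn ℝ t) (hf : ContDiffOn ℝ n f t) (ha : a ∈ s) :
    taylorWithinEval f n s a x = taylorWithinEval f n t a x := by
  simp only [taylor_within_apply]
  refine Finset.sum_congr rfl fun k hk => ?_
  rw [iteratedDerivWithin_subset hst hs ht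
    (hf.of_le (by exact_mod_cast Finset.mem_range_succ_iff.1 hk)) ha]

/-- The integral remainder is rescaled to the interval `[0, 1]`, so that its dependence on `x` is
a power of `x - a` and the argument of the derivative. -/
theorem sub_taylorWithinEval_Ici_eq_integral (hf : ContDiffOn ℝ (n + 1 : ℕ) f (Ici a))
    (hx : a < x) :
    f x - taylorWithinEval f n (Ici a) a x = (x - a) ^ (n + 1) *
      ∫ θ in 0..1, (1 - θ) ^ n / n ! * iteratedDerivWithin (n + 1) f (Ici a) (a + (x - a) * θ) := by
  have hsub : uIcc a x ⊆ Ici a := by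
    rw [uIcc_of_le hx.le]
    exact Icc_subset_Ici_self
  have huniq : UniqueDiffOn ℝ (uIcc a x) := uniqueDiffOn_uIcc hx.ne
  have hderiv {t : ℝ} (ht : t ∈ uIcc a x) :
      iteratedDerivWithin (n + 1) f (uIcc a x) t = iteratedDerivWithin (n + 1) f (Ici a) t :=
    iteratedDerivWithin_subset hsub huniq (uniqueDiffOn_Ici a) hf ht
  rw [← taylorWithinEval_subset hsub huniq (uniqueDiffOn_Ici a) (hf.of_le (by norm_cast; simp))
    left_mem_uIcc, taylor_integral_remainder (hf.mono hsub)]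
  calc ∫ t in a..x, ((x - t) ^ n / n !) • iteratedDerivWithin (n + 1) f (uIcc a x) t
      = ∫ t in (a + (x - a) * 0)..(a + (x - a) * 1),
          (x - t) ^ n / n ! * iteratedDerivWithin (n + 1) f (Ici a) t := by
        rw [mul_zero, add_zero, mul_one, add_sub_cancel]
        exact intervalIntegral.integral_congr fun t ht => by simp only [hderiv ht, smul_eq_mul]
    _ = _ := by
        rw [← intervalIntegral.smul_integral_comp_add_mul, smul_eq_mul, pow_succ', mul_assoc,
          ← intervalIntegral.integral_const_mul ((x - a) ^ n)]
        congr 1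
        refine intervalIntegral.integral_congr fun θ _ => ?_
        rw [show x - (a + (x - a) * θ) = (x - a) * (1 - θ) by ring, mul_pow]
        ring

theorem monotoneOn_iteratedDerivWithin_Ici (hf : AbsolutelyMonotoneOn f (Ici a)) (n : ℕ) :
    MonotoneOn (iteratedDerivWithin n f (Ici a)) (Ici a) := by
  have hdiff : DifferentiableOn ℝ (iteratedDerivWithin n f (Ici a)) (Ici a) :=
    hf.contDiffOn.differentiableOn_iteratedDerivWithin (by exact_mod_cast WithTop.coe_lt_top _)
      (uniqueDiffOn_Ici a)
  refine monotoneOn_of_hasDerivWithinAt_nonneg (convex_Ici a) hdiff.continuousOn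
    (fun x hx => ?_) fun x hx => hf.iteratedDerivWithin_nonneg (uniqueDiffOn_Ici a) (n + 1)
      (interior_subset hx)
  rw [iteratedDerivWithin_succ]
  exact (hdiff x (interior_subset hx)).hasDerivWithinAt.mono interior_subset

theorem sub_taylorWithinEval_Ici_le (hf : AbsolutelyMonotoneOn f (Ici a)) (hx : a < x)
    (hxy : x ≤ y) :
    f x - taylorWithinEval f n (Ici a) a x ≤
      ((x - a) / (y - a)) ^ (n + 1) * (f y - taylorWithinEval f n (Ici a) a y) := by
  have hsmooth : ContDiffOn ℝ (n + 1 : ℕ) f (Ici a) :=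
    hf.contDiffOn.of_le (by exact_mod_cast le_top)
  have hmem {z θ : ℝ} (hz : a < z) (hθ : θ ∈ Icc (0 : ℝ) 1) : a + (z - a) * θ ∈ Ici a :=
    le_add_of_nonneg_right (mul_nonneg (sub_nonneg.2 hz.le) hθ.1)
  have hintegrable {z : ℝ} (hz : a < z) : IntervalIntegrable (fun θ => (1 - θ) ^ n / n ! *
      iteratedDerivWithin (n + 1) f (Ici a) (a + (z - a) * θ)) volume 0 1 := by
    refine ContinuousOn.intervalIntegrable_of_Icc zero_le_one (ContinuousOn.mul (by fun_prop) ?_)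
    exact (hsmooth.continuousOn_iteratedDerivWithin le_rfl (uniqueDiffOn_Ici a)).comp
      (by fun_prop) fun θ hθ => hmem hz hθ
  have hy : a < y := hx.trans_le hxy
  rw [sub_taylorWithinEval_Ici_eq_integral hsmooth hx,
    sub_taylorWithinEval_Ici_eq_integral hsmooth hy, ← mul_assoc, div_pow,
    div_mul_cancel₀ _ (pow_ne_zero _ (sub_pos.2 hy).ne')]
  refine mul_le_mul_of_nonneg_left ?_ (pow_nonneg (sub_nonneg.2 hx.le) _)
  refine intervalIntegral.integral_mono_on zero_le_one (hintegrable hx) (hintegrable hy)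
    fun θ hθ => ?_
  refine mul_le_mul_of_nonneg_left ?_
    (div_nonneg (pow_nonneg (sub_nonneg.2 hθ.2) n) (Nat.cast_nonneg _))
  refine monotoneOn_iteratedDerivWithin_Ici hf (n + 1) (hmem hx hθ) (hmem hy hθ) ?_
  gcongr
  exact hθ.1

theorem taylorWithinEval_Ici_mem_Icc (hf : AbsolutelyMonotoneOn f (Ici a)) (hx : a < x) (n : ℕ) :
    taylorWithinEval f n (Ici a) a x ∈ Icc 0 (f x) := by
  constructor
  · rw [taylor_within_apply]
    exact Finset.sum_nonneg fun k _ => mul_nonneg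
      (mul_nonneg (by positivity) (pow_nonneg (sub_nonneg.2 hx.le) k))
      (hf.iteratedDerivWithin_nonneg (uniqueDiffOn_Ici a) k self_mem_Ici)
  · rw [← sub_nonneg, sub_taylorWithinEval_Ici_eq_integral
      (hf.contDiffOn.of_le (by exact_mod_cast le_top)) hx]
    refine mul_nonneg (pow_nonneg (sub_nonneg.2 hx.le) _)
      (intervalIntegral.integral_nonneg zero_le_one fun θ hθ => mul_nonneg
        (div_nonneg (pow_nonneg (sub_nonneg.2 hθ.2) n) (Nat.cast_nonneg _))
        (hf.iteratedDerivWithin_nonneg (uniqueDiffOn_Ici a) (n + 1) ?_))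
    exact le_add_of_nonneg_right (mul_nonneg (sub_nonneg.2 hx.le) hθ.1)

theorem tendsto_taylorWithinEval_Ici (hf : AbsolutelyMonotoneOn f (Ici a)) (hx : a < x) :
    Tendsto (fun n => taylorWithinEval f n (Ici a) a x) atTop (𝓝 (f x)) := by
  let y := a + 2 * (x - a)
  have hxy : x < y := by linarith
  have hratio : (x - a) / (y - a) = 1 / 2 := by
    rw [add_sub_cancel_left, div_mul_cancel_right₀ (sub_pos.2 hx).ne', one_div]
  have hlower (n : ℕ) : f x - (1 / 2) ^ (n + 1) * f y ≤ taylorWithinEval f n (Ici a) a x := by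
    have hpoly := (taylorWithinEval_Ici_mem_Icc hf (hx.trans hxy) n).1
    refine sub_le_comm.1 ((sub_taylorWithinEval_Ici_le hf hx hxy.le).trans ?_)
    rw [hratio]
    exact mul_le_mul_of_nonneg_left (sub_le_self _ hpoly) (by positivity)
  have hlim : Tendsto (fun n : ℕ => f x - (1 / 2) ^ (n + 1) * f y) atTop (𝓝 (f x)) := by
    have hpow := (tendsto_pow_atTop_nhds_zero_of_lt_one (r := (1 / 2 : ℝ)) (by norm_num)
      (by norm_num)).comp (tendsto_add_atTop_nat 1)
    simpa using (hpow.mul_const (f y)).const_sub (f x)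
  exact tendsto_of_tendsto_of_tendsto_of_le_of_le hlim tendsto_const_nhds hlower
    fun n => (taylorWithinEval_Ici_mem_Icc hf hx n).2

theorem hasSum_taylor_Ici (hf : AbsolutelyMonotoneOn f (Ici a)) (hx : a ≤ x) :
    HasSum (fun k => iteratedDerivWithin k f (Ici a) a / k ! * (x - a) ^ k) (f x) := by
  rcases hx.eq_or_lt with rfl | hx
  · convert hasSum_single (f := fun k => iteratedDerivWithin k f (Ici a) a / k ! * (a - a) ^ k) 0
      fun k hk => by simp [hk] using 1
    simp
  have hterm (k : ℕ) : 0 ≤ iteratedDerivWithin k f (Ici a) a / k ! * (x - a) ^ k :=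
    mul_nonneg (div_nonneg (hf.iteratedDerivWithin_nonneg (uniqueDiffOn_Ici a) k self_mem_Ici)
      (by positivity)) (pow_nonneg (sub_nonneg.2 hx.le) k)
  rw [hasSum_iff_tendsto_nat_of_nonneg hterm, ← tendsto_add_atTop_iff_nat 1]
  refine (tendsto_taylorWithinEval_Ici hf hx).congr fun n => ?_
  rw [taylor_within_apply]
  refine Finset.sum_congr rfl fun k _ => ?_
  rw [smul_eq_mul]
  ring

theorem isNonnegPowerSeriesOn_of_absolutelyMonotoneOn (hf : AbsolutelyMonotoneOn f (Ici 0)) :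
    IsNonnegPowerSeriesOn f (Ici 0) :=
  ⟨fun k => iteratedDerivWithin k f (Ici 0) 0 / k !,
    fun k => div_nonneg (hf.iteratedDerivWithin_nonneg (uniqueDiffOn_Ici 0) k self_mem_Ici)
      (by positivity),
    fun x hx => by simpa only [sub_zero] using hasSum_taylor_Ici hf hx⟩

end Bernstein

/-! ### Limits of power series with non-negative coefficients -/

theorem IsNonnegPowerSeriesOn.mono {f : ℝ → ℝ} {s t : Set ℝ} (hf : IsNonnegPowerSeriesOn f t)
    (hst : s ⊆ t) : IsNonnegPowerSeriesOn f s := by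
  obtain ⟨c, hc, hf⟩ := hf
  exact ⟨c, hc, fun x hx => hf x (hst hx)⟩

theorem IsNonnegPowerSeriesOn.continuousOn_Icc {f : ℝ → ℝ} {r : ℝ}
    (hf : IsNonnegPowerSeriesOn f (Icc 0 r)) : ContinuousOn f (Icc 0 r) := by
  obtain ⟨c, hc, hf⟩ := hf
  rcases lt_or_ge r 0 with hr | hr
  · simp [Icc_eq_empty_of_lt hr]
  refine ContinuousOn.congr (f := fun x => ∑' k, c k * x ^ k) ?_ fun x hx => (hf x hx).tsum_eq.symm
  refine continuousOn_tsum (fun k => by fun_prop) (hf r (right_mem_Icc.2 hr)).summable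
    fun k x hx => ?_
  rw [Real.norm_of_nonneg (mul_nonneg (hc k) (pow_nonneg hx.1 k))]
  exact mul_le_mul_of_nonneg_left (pow_le_pow_left₀ hx.1 hx.2 k) (hc k)

theorem IsNonnegPowerSeriesOn.exists_eqOn_Ioi {F : ℝ → ℝ} (hF : IsNonnegPowerSeriesOn F (Ioi 0)) :
    ∃ G, IsNonnegPowerSeriesOn G univ ∧ EqOn F G (Ioi 0) := by
  obtain ⟨c, hc, hF⟩ := hF
  refine ⟨fun x => ∑' k, c k * x ^ k, ⟨c, hc, fun x _ => ?_⟩, fun x hx => (hF x hx).tsum_eq.symm⟩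
  refine Summable.hasSum ((hF (|x| + 1) (by positivity : 0 < |x| + 1)).summable.of_norm_bounded
    fun k => ?_)
  rw [norm_mul, norm_pow, Real.norm_of_nonneg (hc k), Real.norm_eq_abs]
  exact mul_le_mul_of_nonneg_left (pow_le_pow_left₀ (abs_nonneg x) (le_add_of_nonneg_right
    zero_le_one) k) (hc k)

/-- A diagonal subsequence makes all coefficients converge; the value at `2 * x` bounds the terms
at `x` by a geometric series. -/
theorem exists_subseq_tendsto_isNonnegPowerSeriesOn {f : ℕ → ℝ → ℝ} {B : ℝ → ℝ}
    (hf : ∀ n, IsNonnegPowerSeriesOn (f n) (Ici 0)) (hB : ∀ n, ∀ x ∈ Ici 0, f n x ≤ B x) :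
    ∃ g, ∃ σ : ℕ → ℕ, IsNonnegPowerSeriesOn g (Ici 0) ∧ StrictMono σ ∧
      ∀ x ∈ Ici 0, Tendsto (fun n => f (σ n) x) atTop (𝓝 (g x)) := by
  choose c hc hf using hf
  have hcoeff (n k : ℕ) {x : ℝ} (hx : x ∈ Ici 0) : c n k * x ^ k ≤ B x :=
    (le_hasSum (hf n x hx) k fun j _ => mul_nonneg (hc n j) (pow_nonneg hx j)).trans (hB n x hx)
  have hterm (n k : ℕ) {x : ℝ} (hx : x ∈ Ici 0) : ‖c n k * x ^ k‖ ≤ B (2 * x) * (1 / 2) ^ k := by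
    rw [Real.norm_of_nonneg (mul_nonneg (hc n k) (pow_nonneg hx k))]
    calc c n k * x ^ k = c n k * (2 * x) ^ k * (1 / 2) ^ k := by
          rw [mul_assoc, ← mul_pow, mul_right_comm, mul_one_div_cancel two_ne_zero, one_mul]
      _ ≤ B (2 * x) * (1 / 2) ^ k :=
          mul_le_mul_of_nonneg_right (hcoeff n k (mem_Ici.2 (mul_nonneg zero_le_two hx)))
            (by positivity)
  have hgeom (r : ℝ) : Summable fun k : ℕ => r * (1 / 2 : ℝ) ^ k :=
    summable_geometric_two.mul_left r
  obtain ⟨l, hl, σ, hσ, hcl⟩ :=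
    (isCompact_univ_pi fun _ : ℕ => isCompact_Icc (a := (0 : ℝ)) (b := B 1)).tendsto_subseq
      (x := c) fun n k _ => ⟨hc n k, by simpa using hcoeff n k (zero_le_one' ℝ)⟩
  have hlim (k : ℕ) (x : ℝ) : Tendsto (fun n => c (σ n) k * x ^ k) atTop (𝓝 (l k * x ^ k)) :=
    (tendsto_pi_nhds.1 hcl k).mul_const _
  refine ⟨fun x => ∑' k, l k * x ^ k, σ, ⟨l, fun k => (hl k trivial).1, fun x hx => ?_⟩, hσ,
    fun x hx => ?_⟩
  · exact ((hgeom (B (2 * x))).of_norm_bounded fun k =>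
      le_of_tendsto (hlim k x).norm (.of_forall fun n => hterm (σ n) k hx)).hasSum
  · simpa only [(hf _ x hx).tsum_eq] using tendsto_tsum_of_dominated_convergence
      (hgeom (B (2 * x))) (fun k => hlim k x) (.of_forall fun n k => hterm (σ n) k hx)

/-- A limit `g` of approximations at scales tending to `0` satisfies `Φ ≤ g` on `[0, ∞)` and
`g x ≤ Φ y` for `x < y`, and `g` is continuous from the left. -/
theorem isNonnegPowerSeriesOn_Ioi_of_between {Φ : ℝ → ℝ} (hΦ : Monotone Φ)
    (h : ∀ ε > 0, ∃ f, IsNonnegPowerSeriesOn f (Ici 0) ∧ ∀ x, f x ∈ Icc (Φ x) (Φ (x + ε))) :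
    IsNonnegPowerSeriesOn Φ (Ioi 0) := by
  choose f hf hfΦ using fun n : ℕ => h (1 / (n + 1)) (by positivity)
  have hbound (n : ℕ) (x : ℝ) : f n x ≤ Φ (x + 1) := by
    refine (hfΦ n x).2.trans (hΦ ?_)
    gcongr
    exact div_le_one_of_le₀ (le_add_of_nonneg_left n.cast_nonneg) (by positivity)
  obtain ⟨g, σ, hg, hσ, hlim⟩ :=
    exists_subseq_tendsto_isNonnegPowerSeriesOn hf fun n x _ => hbound n x
  have hΦg {x : ℝ} (hx : x ∈ Ici 0) : Φ x ≤ g x :=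
    ge_of_tendsto (hlim x hx) (.of_forall fun n => (hfΦ (σ n) x).1)
  have hgΦ {x y : ℝ} (hx : x ∈ Ici 0) (hxy : x < y) : g x ≤ Φ y := by
    have hshift : Tendsto (fun n => x + 1 / ((σ n : ℝ) + 1)) atTop (𝓝 x) := by
      simpa using (tendsto_one_div_add_atTop_nhds_zero_nat.comp hσ.tendsto_atTop).const_add x
    refine le_of_tendsto (hlim x hx) ?_
    filter_upwards [hshift.eventually_lt_const hxy] with n hn
    exact (hfΦ (σ n) x).2.trans (hΦ hn.le)
  have hgx {x : ℝ} (hx : 0 < x) : g x ≤ Φ x := by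
    have hcont := (hg.mono Icc_subset_Ici_self).continuousOn_Icc x (right_mem_Icc.2 hx.le)
    rw [ContinuousWithinAt, nhdsWithin_Icc_eq_nhdsLE hx] at hcont
    refine le_of_tendsto (hcont.mono_left (nhdsWithin_mono x Iio_subset_Iic_self)) ?_
    filter_upwards [Ioo_mem_nhdsLT hx] with y hy
    exact hgΦ hy.1.le hy.2
  obtain ⟨c, hc, hgc⟩ := hg
  refine ⟨c, hc, fun x hx => ?_⟩
  have hx₀ : x ∈ Ici 0 := Ioi_subset_Ici_self hx
  rw [(hΦg hx₀).antisymm (hgx hx)]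
  exact hgc x hx₀

/-! ### Transforms of moments of two atoms -/

theorem IsNonnegPowerSeriesOn.preservesTwoAtomMoments {G : ℝ → ℝ}
    (hG : IsNonnegPowerSeriesOn G univ) {u : ℝ} (hu : u ∈ Icc (-1) 1) :
    PreservesTwoAtomMoments u G :=
  preservesTwoAtomMoments_of_forall_mem_momentSet (i := (0 : Fin 1)) (v := fun _ => u)
    (fun _ hx => apply_mem_Icc_of_mem_isCompact (isCompact_cube 1) hx 0)
    (cubeSubmonoid 1).one_mem (fun _ => hu)
    fun _ hs => hG.comp_mem_momentSet (M := cubeSubmonoid 1) (isCompact_cube 1) hs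

theorem pow_three_le_pow_of_ne_one {u : ℝ} (hu : u ∈ Icc (-1) 0) {n : ℕ} (hn : n ≠ 1) :
    u ^ 3 ≤ u ^ n := by
  have h_three : u ^ 3 ≤ 0 := (show Odd 3 by decide).pow_nonpos hu.2
  rcases n.even_or_odd with heven | hodd
  · exact h_three.trans (heven.pow_nonneg u)
  have hn3 : 3 ≤ n := by grind
  have habs : |u| ^ n ≤ |u| ^ 3 :=
    pow_le_pow_of_le_one (abs_nonneg u) (abs_le.2 ⟨hu.1, hu.2.trans zero_le_one⟩) hn3
  rw [← abs_pow, ← abs_pow, abs_of_nonpos h_three] at habs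
  simpa only [neg_neg] using neg_le_of_abs_le habs

namespace PreservesTwoAtomMoments

variable {u : ℝ} {F G : ℝ → ℝ}

theorem monotoneOn (hF : PreservesTwoAtomMoments u F) (hu : u ≤ 0) : MonotoneOn F (Ici 0) := by
  intro x hx y _ hxy
  let b := (y - x) / (1 - u)
  have hb : 0 ≤ b := div_nonneg (sub_nonneg.2 hxy) (by linarith)
  have hby : x - b * u + b = y := by
    have : b * (1 - u) = y - x := div_mul_cancel₀ _ (by linarith)
    linarith
  have ha : 0 ≤ x - b * u :=
    sub_nonneg.2 ((mul_nonpos_of_nonneg_of_nonpos hb hu).trans hx)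
  simpa only [pow_one, pow_zero, mul_one, sub_add_cancel, hby] using (hF ha hb).le_apply_zero 1

/-- `F` is extended to the left of `0` by a constant in order to be mollified. -/
theorem isNonnegPowerSeriesOn_Ioi (hF : PreservesTwoAtomMoments u F) (hu : u ∈ Ioo (-1) 0) :
    IsNonnegPowerSeriesOn F (Ioi 0) := by
  have hmono : Monotone fun x => F (max x 0) := fun x y hxy =>
    hF.monotoneOn hu.2.le (le_max_right x 0) (le_max_right y 0) (max_le_max_right 0 hxy)
  have hpsd (a : ℝ) (ha : a > 0) (b : ℝ) (hb : b ∈ Ioo 0 a) :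
      IsPosSemidefSeq fun n => F (max (a + b * u ^ n) 0) := by
    have hpos (n : ℕ) : 0 ≤ a + b * u ^ n := by
      have hun : |u ^ n| ≤ 1 :=
        (abs_pow u n).trans_le (pow_le_one₀ (abs_nonneg u) (abs_le.2 ⟨hu.1.le, by linarith [hu.2]⟩))
      nlinarith [neg_le_of_abs_le hun, hb.1, hb.2]
    simpa only [max_eq_left (hpos _)] using (hF ha.le hb.1.le).isPosSemidefSeq
  have hseries := isNonnegPowerSeriesOn_Ioi_of_between hmono fun ε hε => by
    obtain ⟨f, hf, hfF⟩ :=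
      exists_absolutelyMonotoneOn_between hmono (injective_pow_of_mem_Ioo hu) hpsd hε
    exact ⟨f, isNonnegPowerSeriesOn_of_absolutelyMonotoneOn hf, hfF⟩
  obtain ⟨c, hc, hsum⟩ := hseries
  exact ⟨c, hc, fun x hx => by simpa only [max_eq_left (mem_Ioi.1 hx).le] using hsum x hx⟩

/-- For `x ≤ 0` choose `a` and `b` with `a + b * u = x` and `a + b * u ^ 3 = 1 - x + x * u ^ 2`;
then `a + b * u ^ n` is positive for all `n ≠ 1`, and the other moments determine the first. -/
theorem eq_of_eqOn_Ioi (hF : PreservesTwoAtomMoments u F) (hG : PreservesTwoAtomMoments u G)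
    (hu : u ∈ Ioo (-1) 0) (h : EqOn F G (Ioi 0)) : F = G := by
  funext x
  rcases lt_or_ge 0 x with hx | hx
  · exact h hx
  have hu_sq : 0 < 1 - u ^ 2 := by nlinarith [hu.1, hu.2]
  let a := (1 - x) / (1 - u ^ 2)
  let b := (x - a) / u
  have ha : 0 ≤ a := div_nonneg (by linarith) hu_sq.le
  have hb : 0 ≤ b := div_nonneg_of_nonpos (by linarith) hu.2.le
  have hbu : b * u = x - a := div_mul_cancel₀ _ hu.2.ne
  have hau : a * (1 - u ^ 2) = 1 - x := div_mul_cancel₀ _ hu_sq.ne'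
  have h_three : 0 < a + b * u ^ 3 := by
    have : a + b * u ^ 3 = 1 - x + x * u ^ 2 := by linear_combination u ^ 2 * hbu + hau
    nlinarith
  have hpos (n : ℕ) (hn : n ≠ 1) : 0 < a + b * u ^ n :=
    h_three.trans_le (add_le_add_right (mul_le_mul_of_nonneg_left
      (pow_three_le_pow_of_ne_one ⟨hu.1.le, hu.2.le⟩ hn) hb) a)
  have h_one := (hF ha hb).apply_one_eq (hG ha hb) fun n hn => h (hpos n hn)
  rwa [pow_one, hbu, add_sub_cancel] at h_one

theorem isNonnegPowerSeriesOn_univ (hF : PreservesTwoAtomMoments u F) (hu : u ∈ Ioo (-1) 0) :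
    IsNonnegPowerSeriesOn F univ := by
  obtain ⟨G, hG, hFG⟩ := (hF.isNonnegPowerSeriesOn_Ioi hu).exists_eqOn_Ioi
  have hu' : u ∈ Icc (-1) 1 := ⟨hu.1.le, hu.2.le.trans zero_le_one⟩
  rwa [hF.eq_of_eqOn_Ioi (hG.preservesTwoAtomMoments hu') hu hFG]

end PreservesTwoAtomMoments

/-! ### Absolutely monotonic entire functions -/

section AbsMonotonicEntire

variable {G : ℂ → ℂ}

theorem absMonotonicEntire_iff_forall_pos :
    AbsMonotonicEntire G ↔
      Differentiable ℂ G ∧ ∀ x : ℝ, 0 < x → ∀ n, 0 ≤ iteratedDeriv n G x := by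
  refine and_congr_right fun _ => forall₃_congr fun x _ n => ?_
  have hn : (0 : ℂ) < (n ! : ℂ) := by exact_mod_cast n.factorial_pos
  constructor
  · rintro ⟨c, hc, h⟩
    rw [(div_eq_iff hn.ne').1 h]
    exact mul_nonneg (Complex.zero_le_real.2 hc) hn.le
  · intro h
    obtain ⟨c, hc, h⟩ := RCLike.nonneg_iff_exists_ofReal.1 (div_nonneg h hn.le)
    exact ⟨c, hc, h.symm⟩

theorem absMonotonicEntire_iff :
    AbsMonotonicEntire G ↔ Differentiable ℂ G ∧ ∀ n, 0 ≤ iteratedDeriv n G 0 := by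
  rw [absMonotonicEntire_iff_forall_pos]
  refine and_congr_right fun hG => ⟨fun h n => ?_, fun h x hx n => ?_⟩
  · have hcont : Continuous fun x : ℝ => iteratedDeriv n G x :=
      (hG.contDiff.continuous_iteratedDeriv n le_rfl).comp Complex.continuous_ofReal
    have hlim : Tendsto (fun x : ℝ => iteratedDeriv n G x) (𝓝[>] 0) (𝓝 (iteratedDeriv n G 0)) :=
      (hcont.tendsto' 0 _ (by simp)).mono_left nhdsWithin_le_nhds
    refine ge_of_tendsto hlim ?_
    filter_upwards [self_mem_nhdsWithin] with x hx using h x hx n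
  · have hd : Differentiable ℂ (iteratedDeriv n G) :=
      hG.contDiff.differentiable_iteratedDeriv n (WithTop.coe_lt_top _)
    refine hd.nonneg_of_iteratedDeriv_nonneg (fun k => ?_) (Complex.zero_le_real.2 hx.le)
    simpa only [iteratedDeriv_eq_iterate, ← Function.iterate_add_apply] using h (k + n)

theorem exists_differentiable_hasSum_iteratedDeriv_zero {c : ℕ → ℂ}
    (hc : ∀ r : NNReal, Summable fun k => ‖c k‖ * r ^ k) :
    ∃ G : ℂ → ℂ, Differentiable ℂ G ∧ (∀ z, HasSum (fun k => c k * z ^ k) (G z)) ∧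
      ∀ k, iteratedDeriv k G 0 = k ! * c k := by
  let p := FormalMultilinearSeries.ofScalars ℂ c
  have hrad : p.radius = ⊤ := p.radius_eq_top_of_summable_norm fun r => by
    simpa only [p, FormalMultilinearSeries.ofScalars_norm] using hc r
  have hball : HasFPowerSeriesOnBall p.sum p 0 ⊤ := hrad ▸ p.hasFPowerSeriesOnBall (by simp [hrad])
  refine ⟨p.sum, fun z => (hball.differentiableOn z (by simp)).differentiableAt (by simp),
    fun z => ?_, fun k => ?_⟩
  · simpa [p, FormalMultilinearSeries.ofScalars_apply_eq, mul_comm] using hball.hasSum (y := z)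
      (by simp)
  · rw [iteratedDeriv_eq_iteratedFDeriv, ← hball.factorial_smul 1 k]
    simp [p]

theorem isNonnegPowerSeriesOn_univ_iff_exists_absMonotonicEntire {F : ℝ → ℝ} :
    IsNonnegPowerSeriesOn F univ ↔ ∃ G, AbsMonotonicEntire G ∧ ∀ x : ℝ, G x = F x := by
  constructor
  · rintro ⟨c, hc, hF⟩
    obtain ⟨G, hG, hsum, hderiv⟩ := exists_differentiable_hasSum_iteratedDeriv_zero
      (c := fun k => c k) fun r => by
        simpa [abs_of_nonneg (hc _)] using (hF r trivial).summable
    refine ⟨G, absMonotonicEntire_iff.2 ⟨hG, fun n => ?_⟩, fun x => ?_⟩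
    · rw [hderiv]
      exact_mod_cast mul_nonneg (Nat.cast_nonneg (α := ℝ) n !) (hc n)
    · exact (hsum x).unique (by exact_mod_cast Complex.hasSum_ofReal.2 (hF x trivial))
  · rintro ⟨G, hG, hGF⟩
    obtain ⟨hdiff, hderiv⟩ := absMonotonicEntire_iff.1 hG
    have hreal (k : ℕ) : ∃ r : ℝ, 0 ≤ r ∧ (r : ℂ) = iteratedDeriv k G 0 :=
      RCLike.nonneg_iff_exists_ofReal.1 (hderiv k)
    choose c hc hcG using hreal
    refine ⟨fun k => (k ! : ℝ)⁻¹ * c k, fun k => mul_nonneg (by positivity) (hc k), fun x _ => ?_⟩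
    rw [← Complex.hasSum_ofReal, ← hGF]
    have hterm (k : ℕ) : (((k ! : ℝ)⁻¹ * c k * x ^ k : ℝ) : ℂ) =
        (k ! : ℂ)⁻¹ • ((x : ℂ) - 0) ^ k • iteratedDeriv k G 0 := by
      rw [← hcG, smul_eq_mul, smul_eq_mul, sub_zero]
      push_cast
      ring
    simpa only [hterm] using Complex.hasSum_taylorSeries_of_entire hdiff 0 (x : ℂ)

end AbsMonotonicEntire

end MomentTransform

open MomentTransform in
theorem theorem8p1_general {d : ℕ} {M : Submonoid (Fin d → ℝ)}
    (hM : IsCompact (M : Set (Fin d → ℝ))) {v : Fin d → ℝ} (hv : v ∈ M) {i : Fin d}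
    (hvi : v i ∈ Set.Ioo (-1) 0) (F : ℝ → ℝ) :
    (∀ s ∈ momentSet (M : Set (Fin d → ℝ)), (fun α => F (s α)) ∈ momentSet (M : Set _)) ↔
      ∃ G : ℂ → ℂ, AbsMonotonicEntire G ∧ ∀ x : ℝ, G x = F x := by
  rw [← isNonnegPowerSeriesOn_univ_iff_exists_absMonotonicEntire]
  refine ⟨fun hF => ?_, fun hF _ hs => hF.comp_mem_momentSet hM hs⟩
  have hpres : PreservesTwoAtomMoments (v i) F := preservesTwoAtomMoments_of_forall_mem_momentSet
    (fun _ hx => apply_mem_Icc_of_mem_isCompact hM hx i) M.one_mem hv hF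
  exact hpres.isNonnegPowerSeriesOn_univ hvi

theorem theorem8p1 (d : ℕ) (hd : 1 ≤ d) (F : ℝ → ℝ) :
    (∀ s ∈ MomentTransform.momentSet (MomentTransform.cube d),
        (fun α => F (s α)) ∈ MomentTransform.momentSet (MomentTransform.cube d)) ↔
      ∃ G : ℂ → ℂ, MomentTransform.AbsMonotonicEntire G ∧ ∀ x : ℝ, G (x : ℂ) = (F x : ℂ) :=
  theorem8p1_general (M := MomentTransform.cubeSubmonoid d) (MomentTransform.isCompact_cube d)
    (v := fun _ => -1 / 2) (fun _ => by norm_num) (i := ⟨0, hd⟩) (by norm_num) F
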